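/- Let $X$ be a real reflexive Banach space with dual $X^*$, let $n>1$, and let $\Omega_1,\dots,\Omega_n$ be nonempty closed convex subsets of $X$ with $\bigcap_{i=1}^n\Omega_i=\emptyset$. For $x\in X$ put $$d(x;\Omega_i)=\inf\{\|x-\omega\|:\omega\in\Omega_i\},\qquad D(x)=\max\{d(x;\Omega_i): i=1,\dots,n\},$$ $$I(x)=\{i\in\{1,\dots,n\}: D(x)=d(x;\Omega_i)\},\qquad \Pi(x;\Omega_i)=\{\omega\in\Omega_i:\|x-\omega\|=d(x;\Omega_i)\}.$$ For $u\in X$ let $\partial\|\cdot\|(u)=\{v\in X^*:\langle v,y-u\rangle\le\|y\|-\|u\|\ \text{for all } y\in X\}$, and for $\omega\in\Omega_i$ let $N(\omega;\Omega_i)=\{v\in X^*:\langle v,y-\omega\rangle\le 0\ \text{for all } y\in\Omega_i\}$. Let $\bar x\in X$. Then $\Pi(\bar x;\Omega_i)\neq\emptyset$ for every $i=1,\dots,n$, and for every choice of $\omega_i\in\Pi(\bar x;\Omega_i)$, $i=1,\dots,n$, setting $$A_i(\bar x)=\partial\|\cdot\|(\bar x-\omega_i)\cap N(\omega_i;\Omega_i),$$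 the point $\bar x$ minimizes $D$ over $X$ if and only if $$0\in\operatorname{co}\Big(\bigcup_{i\in I(\bar x)}A_i(\bar x)\Big),$$ where $\operatorname{co}$ denotes the convex hull in $X^*$ (without closure). -/

import Mathlib

/-- A real normed space is reflexive if the canonical map into its bidual is surjective. -/
def ReflexiveSpace (X : Type*) [NormedAddCommGroup X] [NormedSpace ℝ X] : Prop :=
  Function.Surjective (NormedSpace.inclusionInDoubleDual ℝ X)

/-- The subdifferential of a real function, in the sense of convex analysis. -/
def convexSubdifferential {X : Type*} [NormedAddCommGroup X] [NormedSpace ℝ X]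
    (f : X → ℝ) (x : X) : Set (StrongDual ℝ X) :=
  {v | ∀ y : X, v (y - x) ≤ f y - f x}

/-- The normal cone to a convex set at one of its points. -/
def convexNormalCone {X : Type*} [NormedAddCommGroup X] [NormedSpace ℝ X]
    (x : X) (Ω : Set X) : Set (StrongDual ℝ X) :=
  {v | ∀ y ∈ Ω, v (y - x) ≤ 0}

/-- The set of projections (nearest points) of a point to a set. -/
def projectionSet {X : Type*} [NormedAddCommGroup X] (x : X) (Ω : Set X) : Set X :=
  {w | w ∈ Ω ∧ ‖x - w‖ = Metric.infDist x Ω}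

/-- The largest of the distances from a point to finitely many sets. -/
noncomputable def maxDist {X : Type*} [NormedAddCommGroup X] {n : ℕ}
    (Ω : Fin n → Set X) (x : X) : ℝ :=
  ⨆ i, Metric.infDist x (Ω i)

/-- The set of active indices of the maximal distance at a point. -/
def activeIndices {X : Type*} [NormedAddCommGroup X] {n : ℕ}
    (Ω : Fin n → Set X) (x : X) : Set (Fin n) :=
  {i | maxDist Ω x = Metric.infDist x (Ω i)}

/-- The set `∂‖·‖(x - w) ∩ N(w; Ω)`, meant for a projection `w` of `x` to `Ω`. -/
def projectionSubgradients {X : Type*} [NormedAddCommGroup X] [NormedSpace ℝ X]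
    (x : X) (Ω : Set X) (w : X) : Set (StrongDual ℝ X) :=
  convexSubdifferential (fun y : X => ‖y‖) (x - w) ∩ convexNormalCone w Ω

/-! Reflexivity supplies nearest points through weak compactness. At a nearest point `ω i`, the set
`A_i` is exactly the subdifferential at `x` of the distance to `Ω i`
(`projectionSubgradients_eq_convexSubdifferential`), so the criterion is Fermat's rule for a maximum
of finitely many continuous convex functions. For necessity, Hahn-Banach on `X^n × ℝ^n` yields
weights `c i ≥ 0` and functionals `φ i` with sum zero (`exists_multipliers_of_forall_exists_le`).
Complementary slackness leaves weight only on active indices, where `φ i / c i` is a subgradient;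
the combination is finite, so no closure is needed. For sufficiency, active subgradients are
subgradients of the maximum, and these form a convex set. -/

/-! ### Nearest points in reflexive spaces -/

/-- A bounded set in a reflexive space contains a weak limit of each of its ultrafilters. -/
theorem ReflexiveSpace.exists_weak_limit {X : Type*} [NormedAddCommGroup X] [NormedSpace ℝ X]
    (hX : ReflexiveSpace X) {s : Set X} (hs : Bornology.IsBounded s) (U : Ultrafilter X)
    (hU : s ∈ U) :
    ∃ w : X, ∀ f : StrongDual ℝ X, Filter.Tendsto (fun z => f z) U (nhds (f w)) := by
  obtain ⟨R, hR⟩ := hs.exists_norm_le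
  let J : X → WeakDual ℝ (StrongDual ℝ X) :=
    fun z => StrongDual.toWeakDual (NormedSpace.inclusionInDoubleDual ℝ X z)
  -- Banach-Alaoglu gives a limit in the bidual; reflexivity brings it back to `X`.
  have hc := WeakDual.isCompact_closedBall (𝕜 := ℝ)
    (0 : StrongDual ℝ (StrongDual ℝ X)) R
  have hmem : WeakDual.toStrongDual ⁻¹' Metric.closedBall
      (0 : StrongDual ℝ (StrongDual ℝ X)) R ∈ U.map J := by
    rw [Ultrafilter.mem_map]
    refine Filter.mem_of_superset (Ultrafilter.mem_coe.2 hU) fun z hz => ?_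
    exact (dist_zero_right (NormedSpace.inclusionInDoubleDual ℝ X z)).trans_le
      ((NormedSpace.double_dual_bound ℝ X z).trans (hR z hz))
  obtain ⟨ξ, -, hξ⟩ := hc.ultrafilter_le_nhds' (U.map J) hmem
  obtain ⟨w, hw⟩ := hX (WeakDual.toStrongDual ξ)
  refine ⟨w, fun f => ?_⟩
  have h := (WeakDual.eval_continuous (𝕜 := ℝ) f).tendsto ξ
  have h2 : Filter.Tendsto (fun z => J z f) U (nhds (ξ f)) := h.comp hξ
  have h3 : ξ f = f w := by
    rw [← NormedSpace.dual_def ℝ X w f, hw]; rfl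
  rw [h3] at h2
  exact h2

/-- A closed convex set contains the weak limits of the filters that it belongs to. -/
theorem Convex.mem_of_weak_limit {X : Type*} [NormedAddCommGroup X] [NormedSpace ℝ X]
    {K : Set X} (hK : Convex ℝ K) (hKc : IsClosed K) {l : Filter X} [l.NeBot] (hl : K ∈ l)
    {w : X} (hw : ∀ f : StrongDual ℝ X, Filter.Tendsto (fun z => f z) l (nhds (f w))) :
    w ∈ K := by
  by_contra h
  obtain ⟨f, u, hfw, hfK⟩ := geometric_hahn_banach_point_closed hK hKc h
  have : u ≤ f w := ge_of_tendsto (hw f) (Filter.mem_of_superset hl fun z hz => (hfK z hz).le)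
  linarith

/-- In a reflexive space, nonempty closed convex sets contain nearest points. -/
theorem ReflexiveSpace.projectionSet_nonempty {X : Type*} [NormedAddCommGroup X]
    [NormedSpace ℝ X] (hX : ReflexiveSpace X) {Ω : Set X} (hne : Ω.Nonempty)
    (hclosed : IsClosed Ω) (hconv : Convex ℝ Ω) (x : X) : (projectionSet x Ω).Nonempty := by
  have hex : ∀ k : ℕ, ∃ z ∈ Ω, dist x z < Metric.infDist x Ω + 1 / ((k : ℝ) + 1) := fun k =>
    (Metric.infDist_lt_iff hne).1 (lt_add_of_pos_right _ Nat.one_div_pos_of_nat)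
  choose z hzΩ hz using hex
  let U : Ultrafilter X := (Ultrafilter.of (Filter.atTop : Filter ℕ)).map z
  have hev : ∀ s : Set X, (∀ᶠ k in Filter.atTop, z k ∈ s) → s ∈ U := fun s hs =>
    Ultrafilter.of_le (Filter.atTop : Filter ℕ) hs
  -- Closed balls are closed and convex, so they keep weak limits; this replaces weak lower
  -- semicontinuity of the norm.
  have hball : ∀ r, Metric.infDist x Ω < r → Metric.closedBall x r ∈ U := fun r hr => by
    refine hev _ ?_
    have ht : Filter.Tendsto (fun k : ℕ => Metric.infDist x Ω + 1 / ((k : ℝ) + 1)) Filter.atTop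
        (nhds (Metric.infDist x Ω + 0)) := tendsto_const_nhds.add tendsto_one_div_add_atTop_nhds_zero_nat
    rw [add_zero] at ht
    filter_upwards [ht.eventually_lt_const hr] with k hk
    rw [Metric.mem_closedBall, dist_comm]
    exact ((hz k).trans hk).le
  obtain ⟨w, hw⟩ := hX.exists_weak_limit Metric.isBounded_closedBall U
    (hball (Metric.infDist x Ω + 1) (lt_add_one _))
  have hwΩ : w ∈ Ω :=
    hconv.mem_of_weak_limit hclosed (hev _ (Filter.Eventually.of_forall hzΩ)) hw
  refine ⟨w, hwΩ, le_antisymm (le_of_forall_gt_imp_ge_of_dense fun r hr => ?_) ?_⟩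
  · have := (convex_closedBall x r).mem_of_weak_limit Metric.isClosed_closedBall (hball r hr) hw
    rwa [Metric.mem_closedBall, dist_comm, dist_eq_norm] at this
  · rw [← dist_eq_norm]
    exact Metric.infDist_le_dist_of_mem hwΩ

/-! ### Convexity and subgradients of the distance -/

/-- The distance to a nonempty convex set is a convex function. -/
theorem Convex.convexOn_infDist {X : Type*} [NormedAddCommGroup X] [NormedSpace ℝ X]
    {Ω : Set X} (hconv : Convex ℝ Ω) (hne : Ω.Nonempty) :
    ConvexOn ℝ Set.univ fun y => Metric.infDist y Ω := by
  refine ⟨convex_univ, fun p _ q _ a b ha hb hab => le_of_forall_pos_le_add fun ε hε => ?_⟩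
  obtain ⟨u, hu, hpu⟩ := (Metric.infDist_lt_iff hne).1 (lt_add_of_pos_right (Metric.infDist p Ω) hε)
  obtain ⟨v, hv, hqv⟩ := (Metric.infDist_lt_iff hne).1 (lt_add_of_pos_right (Metric.infDist q Ω) hε)
  rw [dist_eq_norm] at hpu hqv
  have h1 : Metric.infDist (a • p + b • q) Ω ≤ dist (a • p + b • q) (a • u + b • v) :=
    Metric.infDist_le_dist_of_mem (hconv hu hv ha hb hab)
  have h2 : a • p + b • q - (a • u + b • v) = a • (p - u) + b • (q - v) := by module
  rw [dist_eq_norm, h2] at h1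
  have h3 := norm_add_le (a • (p - u)) (b • (q - v))
  rw [norm_smul, norm_smul, Real.norm_of_nonneg ha, Real.norm_of_nonneg hb] at h3
  have h4 := mul_le_mul_of_nonneg_left hpu.le ha
  have h5 := mul_le_mul_of_nonneg_left hqv.le hb
  have h6 : a * ε + b * ε = ε := by rw [← add_mul, hab, one_mul]
  simp only [smul_eq_mul]
  linarith

/-- The subdifferential of the distance to a set, in terms of a projection of the point. -/
theorem projectionSubgradients_eq_convexSubdifferential {X : Type*} [NormedAddCommGroup X]
    [NormedSpace ℝ X] {Ω : Set X} {x w : X} (hw : w ∈ projectionSet x Ω) :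
    projectionSubgradients x Ω w = convexSubdifferential (fun y => Metric.infDist y Ω) x := by
  obtain ⟨hwΩ, hwd⟩ := hw
  ext v
  constructor
  · rintro ⟨h1, h2⟩ y
    change v (y - x) ≤ Metric.infDist y Ω - Metric.infDist x Ω
    rw [← hwd, le_sub_iff_add_le]
    refine (Metric.le_infDist ⟨w, hwΩ⟩).2 fun {z} hz => ?_
    have h3 : v (y - z - (x - w)) ≤ ‖y - z‖ - ‖x - w‖ := h1 (y - z)
    have h4 := h2 z hz
    have h5 : v (y - x) = v (y - z - (x - w)) + v (z - w) := by
      rw [← map_add]; congr 1; abel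
    rw [dist_eq_norm]
    linarith
  · intro h
    refine ⟨fun z => ?_, fun y hy => ?_⟩
    · have h1 : v (z + w - x) ≤ Metric.infDist (z + w) Ω - Metric.infDist x Ω := h (z + w)
      have h2 : Metric.infDist (z + w) Ω ≤ ‖z‖ := by
        simpa [dist_eq_norm] using Metric.infDist_le_dist_of_mem (x := z + w) hwΩ
      have h3 : z - (x - w) = z + w - x := by abel
      change v (z - (x - w)) ≤ ‖z‖ - ‖x - w‖
      rw [h3, hwd]
      linarith
    · have h1 := h (x + (y - w))
      -- Translating `x` and `w` together by `y - w` keeps their distance and ends at a point of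
      -- `Ω`.
      have h2 : Metric.infDist (x + (y - w)) Ω ≤ ‖x - w‖ := by
        have h3 := Metric.infDist_le_dist_of_mem (x := x + (y - w)) hy
        rwa [dist_eq_norm, show x + (y - w) - y = x - w by abel] at h3
      rw [add_sub_cancel_left] at h1
      linarith

/-! ### Multipliers and the maximum rule -/

/-- If the pointwise maximum of finitely many continuous convex functions is bounded below by `M`,
then so is a convex combination of them, even after decoupling their arguments at the cost of
linear functionals with sum zero. -/
theorem exists_multipliers_of_forall_exists_le {X ι : Type*} [NormedAddCommGroup X]
    [NormedSpace ℝ X] [Fintype ι] [Nonempty ι] {g : ι → X → ℝ}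
    (hg : ∀ i, ConvexOn ℝ Set.univ (g i)) (hgc : ∀ i, Continuous (g i)) {M : ℝ}
    (hM : ∀ y, ∃ i, M ≤ g i y) :
    ∃ (c : ι → ℝ) (φ : ι → StrongDual ℝ X), (∀ i, 0 ≤ c i) ∧ 0 < ∑ i, c i ∧ ∑ i, φ i = 0 ∧
      ∀ h : ι → X, ∑ i, φ i (h i) ≤ ∑ i, c i * (g i (h i) - M) := by
  classical
  -- Each function gets its own argument; the diagonal `T` forces the arguments to agree, and `hM`
  -- then says that `S` and `T` are disjoint.
  let S : Set ((ι → X) × (ι → ℝ)) := {p | ∀ i, g i (p.1 i) + p.2 i < M}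
  let T : Set ((ι → X) × (ι → ℝ)) := Set.range fun y : X => (fun _ => y, 0)
  have hSo : IsOpen S := by
    simp only [S, Set.ofPred_forall]
    exact isOpen_iInter_of_finite fun i => isOpen_lt (by fun_prop) continuous_const
  have hSc : Convex ℝ S := by
    intro p hp q hq a b ha hb hab i
    have h1 := (hg i).2 (Set.mem_univ (p.1 i)) (Set.mem_univ (q.1 i)) ha hb hab
    have h2 : a * (g i (p.1 i) + p.2 i) + b * (g i (q.1 i) + q.2 i) < M :=
      (convex_Iio M) (hp i) (hq i) ha hb hab
    simp only [smul_eq_mul, Prod.fst_add, Prod.snd_add, Prod.smul_fst, Prod.smul_snd,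
      Pi.add_apply, Pi.smul_apply] at h1 ⊢
    linarith
  have hTc : Convex ℝ T := by
    rintro _ ⟨y, rfl⟩ _ ⟨z, rfl⟩ a b - - -
    refine ⟨a • y + b • z, ?_⟩
    ext <;> simp
  have hdisj : Disjoint S T := by
    rw [Set.disjoint_left]
    rintro _ hp ⟨y, rfl⟩
    obtain ⟨i, hi⟩ := hM y
    have := hp i
    simp only [Pi.zero_apply, add_zero] at this
    linarith
  obtain ⟨f, u, hfS, hfT⟩ := geometric_hahn_banach_open hSc hSo hTc hdisj
  -- A functional bounded below on a subspace vanishes there: otherwise rescale to reach the value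
  -- `u - 1`.
  have hdiag : ∀ y : X, f (fun _ => y, 0) = 0 := by
    intro y
    by_contra hne
    have h1 : u ≤ f (fun _ => ((u - 1) / f (fun _ => y, 0)) • y, 0) := hfT _ ⟨_, rfl⟩
    have h2 : ((fun _ => ((u - 1) / f (fun _ => y, 0)) • y, 0) : (ι → X) × (ι → ℝ)) =
        ((u - 1) / f (fun _ => y, 0)) • (fun _ => y, 0) := by
      ext <;> simp
    rw [h2, map_smul, smul_eq_mul, div_mul_cancel₀ _ hne] at h1
    linarith
  have hu : u ≤ 0 := by
    have h1 := hfT _ ⟨0, rfl⟩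
    rwa [hdiag] at h1
  have hneg : ∀ p ∈ S, f p < 0 := fun p hp => (hfS p hp).trans_le hu
  let φ : ι → StrongDual ℝ X := fun i =>
    f.comp ((ContinuousLinearMap.inl ℝ (ι → X) (ι → ℝ)).comp
      (ContinuousLinearMap.single ℝ (fun _ => X) i))
  let c : ι → ℝ := fun i => f (0, Pi.single i 1)
  have hf : ∀ h t, f (h, t) = ∑ i, φ i (h i) + ∑ i, c i * t i := by
    intro h t
    have h1 : ((h, t) : (ι → X) × (ι → ℝ)) =
        ∑ i, ((Pi.single i (h i), 0) : (ι → X) × (ι → ℝ)) +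
          ∑ i, t i • ((0, Pi.single i 1) : (ι → X) × (ι → ℝ)) := by
      ext j <;> simp [Prod.fst_sum, Prod.snd_sum, Finset.sum_apply, Pi.single_apply]
    rw [h1, map_add, map_sum, map_sum]
    congr 1
    refine Finset.sum_congr rfl fun i _ => ?_
    rw [map_smul, smul_eq_mul, mul_comm]
  let K : ℝ := ∑ i, |g i 0 - M| + 1
  have hK : ∀ i, g i 0 - M < K := fun i => by
    have := Finset.single_le_sum (f := fun i => |g i 0 - M|) (fun _ _ => abs_nonneg _)
      (Finset.mem_univ i)
    have := le_abs_self (g i 0 - M)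
    simp only [K]
    linarith
  have hK0 : 0 < K := by positivity
  have hc : ∀ j, 0 ≤ c j := by
    intro j
    by_contra! hj
    -- Lowering coordinate `j` by this `τ` stays in `S` but brings `f` up to zero.
    let τ : ℝ := f (0, fun _ => -K) / c j
    have hbase : f (0, fun _ => -K) < 0 := hneg _ fun i => by
      have := hK i
      simp only [Pi.zero_apply]
      linarith
    have hτ : 0 < τ := div_pos_of_neg_of_neg hbase hj
    have h1 := hneg ((0, fun _ => -K) - τ • (0, Pi.single j 1)) fun i => by
      have h2 := hK i
      have h3 : 0 ≤ τ * (Pi.single j (1 : ℝ) : ι → ℝ) i := by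
        refine mul_nonneg hτ.le ?_
        rw [Pi.single_apply]
        split_ifs <;> norm_num
      simp only [Prod.fst_sub, Prod.snd_sub, Prod.smul_fst, Prod.smul_snd, smul_zero, sub_zero,
        Pi.zero_apply, Pi.sub_apply, Pi.smul_apply, smul_eq_mul]
      linarith
    rw [map_sub, map_smul, smul_eq_mul] at h1
    have h4 : τ * f (0, Pi.single j 1) = f (0, fun _ => -K) := div_mul_cancel₀ _ hj.ne
    linarith
  refine ⟨c, φ, hc, ?_, ?_, fun h => ?_⟩
  · have h1 := hneg (0, fun _ => -K) fun i => by
      have := hK i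
      simp only [Pi.zero_apply]
      linarith
    rw [hf] at h1
    simp only [Pi.zero_apply, map_zero, Finset.sum_const_zero, zero_add, ← Finset.sum_mul] at h1
    nlinarith
  · ext y
    have h1 := hdiag y
    rw [hf] at h1
    simpa [sum_apply] using h1
  · refine le_of_forall_pos_le_add fun ε hε => ?_
    let δ : ℝ := ε / (∑ i, c i + 1)
    have hs : 0 ≤ ∑ i, c i := Finset.sum_nonneg fun i _ => hc i
    have hδ : 0 < δ := by positivity
    have hδ' : (∑ i, c i) * δ ≤ ε := by
      have : δ * (∑ i, c i + 1) = ε := div_mul_cancel₀ _ (by positivity)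
      linarith
    -- This point lies `δ` below the boundary of `S` in every coordinate.
    have h1 := hneg (h, fun i => M - g i (h i) - δ) fun i => by
      simp only
      linarith
    rw [hf] at h1
    have h2 : ∑ i, c i * (M - g i (h i) - δ) =
        -(∑ i, c i * (g i (h i) - M)) - (∑ i, c i) * δ := by
      rw [Finset.sum_mul, ← Finset.sum_neg_distrib, ← Finset.sum_sub_distrib]
      exact Finset.sum_congr rfl fun i _ => by ring
    linarith

/-- At a minimizer of the maximum of finitely many continuous convex functions, zero is a convex
combination of subgradients of the functions that attain the maximum. -/
theorem zero_mem_convexHull_convexSubdifferential {X ι : Type*} [NormedAddCommGroup X]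
    [NormedSpace ℝ X] [Fintype ι] [Nonempty ι] {g : ι → X → ℝ}
    (hg : ∀ i, ConvexOn ℝ Set.univ (g i)) (hgc : ∀ i, Continuous (g i)) {M : ℝ} {x : X}
    (hx : ∀ i, g i x ≤ M) (hM : ∀ y, ∃ i, M ≤ g i y) :
    (0 : StrongDual ℝ X) ∈
      convexHull ℝ (⋃ i ∈ {i | M = g i x}, convexSubdifferential (g i) x) := by
  classical
  obtain ⟨c, φ, hc, hcs, hφ, hle⟩ := exists_multipliers_of_forall_exists_le hg hgc hM
  have hterm : ∀ i, c i * (g i x - M) = 0 := by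
    have hnp : ∀ i ∈ Finset.univ, c i * (g i x - M) ≤ 0 := fun i _ =>
      mul_nonpos_of_nonneg_of_nonpos (hc i) (sub_nonpos.2 (hx i))
    have h0 : ∑ i, c i * (g i x - M) = 0 := by
      refine le_antisymm (Finset.sum_nonpos hnp) ?_
      have h1 := hle fun _ => x
      rwa [← sum_apply, hφ, zero_apply] at h1
    exact fun i => (Finset.sum_eq_zero_iff_of_nonpos hnp).1 h0 i (Finset.mem_univ i)
  have hsub : ∀ i y, φ i (y - x) ≤ c i * (g i y - g i x) := by
    intro i y
    -- Moving only argument `i` away from `x` isolates `φ i`, as the other terms on the right vanish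
    -- by `hterm`.
    have h1 := hle (Function.update (fun _ => x) i y)
    have h2 : ∑ j, φ j (Function.update (fun _ => x) i y j) = φ i (y - x) := by
      have h3 : ∑ j, φ j x = 0 := by
        rw [← sum_apply, hφ, zero_apply]
      rw [← sub_zero (∑ j, _), ← h3, ← Finset.sum_sub_distrib,
        Finset.sum_eq_single_of_mem i (Finset.mem_univ i) fun j _ hj => by simp [hj]]
      simp
    have h4 : ∑ j, c j * (g j (Function.update (fun _ => x) i y j) - M) = c i * (g i y - M) := by
      rw [Finset.sum_eq_single_of_mem i (Finset.mem_univ i) fun j _ hj => by simp [hj, hterm j]]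
      simp
    rw [h2, h4] at h1
    linarith [hterm i]
  have hzero : ∀ i, c i = 0 → φ i = 0 := by
    intro i hi
    ext y
    have h1 := hsub i (x + y)
    have h2 := hsub i (x - y)
    rw [hi, zero_mul] at h1 h2
    rw [add_sub_cancel_left] at h1
    rw [sub_sub_cancel_left, map_neg] at h2
    exact le_antisymm h1 (by simpa using h2)
  have hsum : ∑ i with 0 < c i, c i = ∑ i, c i :=
    Finset.sum_filter_of_ne fun i _ hi => (hc i).lt_of_ne' hi
  have hmem := Finset.centerMass_mem_convexHull (R := ℝ)
    (s := ⋃ i ∈ {i | M = g i x}, convexSubdifferential (g i) x)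
    (Finset.univ.filter fun i => 0 < c i) (w := c) (z := fun i => (c i)⁻¹ • φ i)
    (fun i _ => hc i) (by rwa [hsum]) fun i hi => by
      have hi' : 0 < c i := (Finset.mem_filter.1 hi).2
      refine Set.mem_iUnion₂.2 ⟨i, ?_, fun y => ?_⟩
      · have := (mul_eq_zero.1 (hterm i)).resolve_left hi'.ne'
        exact (sub_eq_zero.1 this).symm
      · rw [smul_apply, smul_eq_mul, inv_mul_le_iff₀ hi']
        exact hsub i y
  have hcm : (Finset.univ.filter fun i => 0 < c i).centerMass c (fun i => (c i)⁻¹ • φ i) = 0 := by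
    rw [Finset.centerMass]
    have : ∑ i with 0 < c i, c i • (c i)⁻¹ • φ i = ∑ i, φ i := by
      rw [← Finset.sum_filter_of_ne (p := fun i => 0 < c i)
        fun i _ hi => (hc i).lt_of_ne' fun h => hi (hzero i h)]
      exact Finset.sum_congr rfl fun i hi => smul_inv_smul₀ (Finset.mem_filter.1 hi).2.ne' _
    rw [this, hφ, smul_zero]
  rwa [hcm] at hmem

/-- Subdifferentials are convex. -/
theorem convex_convexSubdifferential {X : Type*} [NormedAddCommGroup X] [NormedSpace ℝ X]
    (f : X → ℝ) (x : X) : Convex ℝ (convexSubdifferential f x) := by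
  intro v hv w hw a b ha hb hab y
  exact (convex_Iic (f y - f x)) (hv y) (hw y) ha hb hab

theorem infDist_le_maxDist {X : Type*} [NormedAddCommGroup X] {n : ℕ} (Ω : Fin n → Set X)
    (y : X) (i : Fin n) : Metric.infDist y (Ω i) ≤ maxDist Ω y :=
  le_ciSup (f := fun i => Metric.infDist y (Ω i)) (Set.finite_range _).bddAbove i

theorem proposition3p10 {X : Type*} [NormedAddCommGroup X] [NormedSpace ℝ X] [CompleteSpace X]
    (hX : ReflexiveSpace X) {n : ℕ} (hn : 1 < n) (Ω : Fin n → Set X)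
    (hne : ∀ i, (Ω i).Nonempty) (hclosed : ∀ i, IsClosed (Ω i)) (hconv : ∀ i, Convex ℝ (Ω i))
    (hinter : ⋂ i, Ω i = ∅) (x : X) :
    (∀ i, (projectionSet x (Ω i)).Nonempty) ∧
    ∀ ω : Fin n → X, (∀ i, ω i ∈ projectionSet x (Ω i)) →
      ((∀ y : X, maxDist Ω x ≤ maxDist Ω y) ↔
        (0 : StrongDual ℝ X) ∈
          convexHull ℝ (⋃ i ∈ activeIndices Ω x, projectionSubgradients x (Ω i) (ω i))) := by
  have : Nonempty (Fin n) := ⟨⟨0, by omega⟩⟩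
  refine ⟨fun i => hX.projectionSet_nonempty (hne i) (hclosed i) (hconv i) x, fun ω hω => ?_⟩
  simp only [fun i => projectionSubgradients_eq_convexSubdifferential (hω i)]
  constructor
  · intro hmin
    refine zero_mem_convexHull_convexSubdifferential (g := fun i y => Metric.infDist y (Ω i))
      (fun i => (hconv i).convexOn_infDist (hne i)) (fun i => Metric.continuous_infDist_pt _)
      (infDist_le_maxDist Ω x) fun y => ?_
    obtain ⟨i, hi⟩ := exists_eq_ciSup_of_finite (f := fun i => Metric.infDist y (Ω i))
    exact ⟨i, (hmin y).trans_eq hi.symm⟩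
  · intro h0 y
    have hsub : (⋃ i ∈ activeIndices Ω x,
        convexSubdifferential (fun y => Metric.infDist y (Ω i)) x) ⊆
          convexSubdifferential (maxDist Ω) x := by
      refine Set.iUnion₂_subset fun i hi v hv z => (hv z).trans ?_
      have hi' : maxDist Ω x = Metric.infDist x (Ω i) := hi
      have := infDist_le_maxDist Ω z i
      simp only
      linarith
    have h1 := convexHull_min hsub (convex_convexSubdifferential _ _) h0 y
    rw [zero_apply] at h1
    linarith
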